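/- Let $H$ be a complex Hilbert space, $\mathcal B\subseteq\mathcal B(H)$ a unital $*$-subalgebra, $d\ge 0$ an integer, and $\lambda^\mu_\nu:\mathcal B\to\mathcal B$ ($\mu\in\{-,1,\dots,d\}$, $\nu\in\{+,1,\dots,d\}$) linear maps. For $f\in\mathbb C^d\otimes L^2(\mathbb R_+)$ let $f^\otimes$ be the coherent (exponential) vector $f^\otimes(\tau)=\prod_{(t,n)\in\tau}f^n(t)$ in the symmetric Fock space $\mathcal F$ over $\mathbb C^d\otimes L^2(\mathbb R_+)$, so that $\langle f^\otimes|h^\otimes\rangle=e^{\langle f|h\rangle}$, and let $\mathcal D\subseteq H\otimes\mathcal F$ be the linear span of the vectors $\xi\otimes f^\otimes$, $\xi\in H$. A $\mathcal D$-form is a sesquilinear form on $\mathcal D$; it is adapted at time $t$ if it is the product of a form over the Fock space of $[0,t)$ and the identity of the Fock space of $[t,\infty)$. Let $\Lambda_-^+(t)=tI$, $\Lambda_-^n(t)$ (annihilation), $\Lambda_m^+(t)$ (creation) and $\Lambda_m^n(t)$ (exchange, number) be the standard quantum stochastic integrators. Suppose that the quantum stochastic equation $$d\phi_t(Y)=\sum_{\mu,\nu}\phi_t(\lambda^\mu_\nu(Y))\,d\Lambda^\nu_\mu(t),\qquad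 \phi_0(Y)=Y\otimes I,\qquad Y\in\mathcal B,$$ has an adapted solution $(\phi_t)_{t\ge0}$, consisting of linear maps from $\mathcal B$ into the $\mathcal D$-forms, such that $\phi_t$ is completely positive for all $t>0$, that is, $\sum_{k,l}\langle\psi_k|\phi_t(B_k^\dagger B_l)\psi_l\rangle\ge0$ for all finite families $B_k\in\mathcal B$, $\psi_k\in\mathcal D$. Here stochastic integrals of adapted form-valued processes are the limits, in the matrix elements between the vectors $\xi\otimes f^\otimes$, of the integrals of simple adapted processes $\sum_i X_{t_i}\mathbf 1_{[t_i,t_{i+1})}$, which are $\sum_i X_{t_i}\,(\Lambda^\nu_\mu(t\wedge t_{i+1})-\Lambda^\nu_\mu(t\wedge t_i))$; the simple processes have to approximate the integrand in $L^1([0,t],|f^\mu(s)||h^\nu(s)|\,ds)$, $f^-=1=h^+$, in each matrix element between $\xi\otimes f^\otimes$ and $\eta\otimes h^\otimes$. Define the germ map $\gamma$ from $\mathcal B$ into the bounded operators on $H\oplus(H\otimes\mathbb C^d)$ as the block matrix with entries $\gamma^-_+=\lambda^-_+$, $\gamma^m_+=\lambda^m_+$, $\gamma^-_n=\lambda^-_n$,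 $\gamma^m_n(B)=\lambda^m_n(B)+\delta^m_nB$, acting by $(\gamma(B)\eta)^\mu=\sum_\nu\gamma^\mu_\nu(B)\eta^\nu$, where a vector $\eta=\eta^0\oplus(\eta^1,\dots,\eta^d)$ has the component $\eta^0\in H$ at the index $-$ of a row and $+$ of a column, and let $\iota(B)=B\oplus0$. Then $\gamma$ is conditionally completely positive with respect to $\iota$: for all finite families $B_k\in\mathcal B$ and $\eta_k\in H\oplus(H\otimes\mathbb C^d)$, $$\sum_k\iota(B_k)\eta_k=0\quad\Longrightarrow\quad\sum_{k,l}\langle\eta_k\,|\,\gamma(B_k^\dagger B_l)\eta_l\rangle\ge0 .$$ Moreover $\gamma(B^\dagger)=\gamma(B)^\dagger$ for all $B\in\mathcal B$. -/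

import Mathlib

open MeasureTheory Filter Topology
open scoped ComplexOrder ENNReal

noncomputable section

/-- Indices of the quantum noise with `d` degrees of freedom. As an upper index (row) `none` is the
symbol `-`, as a lower index (column) `none` is the symbol `+`; `some n` is one of `1, …, d`. -/
abbrev NoiseIdx (d : ℕ) : Type := Option (Fin d)

/-! ### One-particle functions -/

/-- A point: a time together with the index of a degree of freedom. -/
abbrev Pt (d : ℕ) : Type := ℝ × Fin d

/-- Lebesgue measure on `[0, ∞)` times counting measure on `{1, …, d}`, so that
`L²(Pt d, ptMeasure d) = ℂ^d ⊗ L²(ℝ₊)`. -/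
def ptMeasure (d : ℕ) : Measure (Pt d) :=
  ((volume : Measure ℝ).restrict (Set.Ici 0)).prod Measure.count

instance (d : ℕ) : SigmaFinite (ptMeasure d) := by unfold ptMeasure; infer_instance

/-- Square-integrable functions `f = (f^1, …, f^d)` on `ℝ₊`. -/
def TestFn (d : ℕ) : Type := {f : Pt d → ℂ // MemLp f 2 (ptMeasure d)}

/-- The past `1_{[0,s)} f` of `f`. -/
def TestFn.past {d : ℕ} (s : ℝ) (f : TestFn d) : TestFn d :=
  ⟨{p : Pt d | p.1 < s}.indicator f.1,
    f.2.indicator (measurableSet_lt measurable_fst measurable_const)⟩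

/-- The future `1_{[s,∞)} f` of `f`. -/
def TestFn.future {d : ℕ} (s : ℝ) (f : TestFn d) : TestFn d :=
  ⟨{p : Pt d | s ≤ p.1}.indicator f.1,
    f.2.indicator (measurableSet_le measurable_const measurable_fst)⟩

/-- The components of `f`, extended by `1` at the index `none`. -/
def TestFn.comp {d : ℕ} (f : TestFn d) : NoiseIdx d → ℝ → ℂ
  | none, _ => 1
  | some n, s => f.1 (s, n)

/-! ### Fock space and coherent vectors -/

/-- Finite configurations `τ = (x_1, …, x_k)` of points. -/
abbrev Conf (d : ℕ) : Type := Σ k : ℕ, (Fin k → Pt d)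

/-- The inclusion of the `k`-point configurations. -/
def confMk (d k : ℕ) : (Fin k → Pt d) → Conf d := fun x => ⟨k, x⟩

/-- The measure `⊕_k (1 / k!) dx_1 ⋯ dx_k` on configurations. The Fock space over
`ℂ^d ⊗ L²(ℝ₊)` is the space of the permutation invariant functions in `L²(confMeasure d)`;
the permutation invariant functions in `L²(confMeasure d; H)` form its tensor product with `H`. -/
def confMeasure (d : ℕ) : Measure (Conf d) :=
  Measure.sum fun k : ℕ =>
    (((k.factorial : ℝ≥0∞)⁻¹) • Measure.pi fun _ : Fin k => ptMeasure d).map (confMk d k)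

/-- The coherent (exponential) function `f^⊗(τ) = ∏_{x ∈ τ} f(x)`. -/
def coh {d : ℕ} (f : Pt d → ℂ) : Conf d → ℂ := fun τ => ∏ i, f (τ.2 i)

theorem measurableEmbedding_conf (d k : ℕ) :
    MeasurableEmbedding (confMk d k) := by
  have hinj : ∀ a : ℕ, Function.Injective (confMk d a) := 
    fun a x y h => by simpa [confMk] using h
  refine ⟨hinj k, ?_, ?_⟩
  · exact Measurable.of_le_map (iInf_le _ k)
  · intro s hs
    have key : ∀ a : ℕ,
        MeasurableSet (confMk d a ⁻¹' (confMk d k '' s)) := by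
      intro a
      by_cases h : k = a
      · subst h
        rwa [Set.preimage_image_eq _ (hinj k)]
      · have : confMk d a ⁻¹' (confMk d k '' s) = ∅ := by
          ext x
          simp only [Set.mem_preimage, Set.mem_image, Set.mem_empty_iff_false, iff_false]
          rintro ⟨y, -, hy⟩
          exact h (congrArg Sigma.fst hy)
        rw [this]
        exact MeasurableSet.empty
    exact MeasurableSpace.measurableSet_iInf.mpr key

theorem coh_memLp {d : ℕ} {f : Pt d → ℂ} (hf : MemLp f 2 (ptMeasure d)) :
    MemLp (coh f) 2 (confMeasure d) := by
  have hmeas : ∀ k : ℕ, AEStronglyMeasurable (fun x : Fin k → Pt d => ∏ i, f (x i))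
      (Measure.pi fun _ : Fin k => ptMeasure d) := by
    intro k
    refine Finset.aestronglyMeasurable_fun_prod _ fun i _ => ?_
    exact hf.1.comp_quasiMeasurePreserving (Measure.quasiMeasurePreserving_eval _ i)
  have hm : AEStronglyMeasurable (coh f) (confMeasure d) := by
    refine aestronglyMeasurable_sum_measure_iff.mpr fun k => ?_
    rw [(measurableEmbedding_conf d k).aestronglyMeasurable_map_iff]
    exact (hmeas k).smul_measure _
  have hsq : Integrable (fun p => ‖f p‖ ^ 2) (ptMeasure d) :=
    (memLp_two_iff_integrable_sq_norm hf.1).mp hf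
  rw [memLp_two_iff_integrable_sq_norm hm]
  refine ⟨(hm.norm.pow 2), ?_⟩
  unfold HasFiniteIntegral confMeasure
  rw [lintegral_sum_measure]
  have hk : ∀ k : ℕ, ∫⁻ τ, ‖‖coh f τ‖ ^ 2‖ₑ
        ∂((((k.factorial : ℝ≥0∞)⁻¹) • Measure.pi fun _ : Fin k => ptMeasure d).map (confMk d k))
      = ENNReal.ofReal ((∫ p, ‖f p‖ ^ 2 ∂(ptMeasure d)) ^ k / k.factorial) := by
    intro k
    rw [(measurableEmbedding_conf d k).lintegral_map, lintegral_smul_measure]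
    have hi : Integrable (fun x : Fin k → Pt d => ∏ i, ‖f (x i)‖ ^ 2)
        (Measure.pi fun _ : Fin k => ptMeasure d) := Integrable.fintype_prod fun _ => hsq
    have h1 : (∫⁻ x : Fin k → Pt d, ‖‖coh f (confMk d k x)‖ ^ 2‖ₑ
          ∂(Measure.pi fun _ : Fin k => ptMeasure d))
        = ENNReal.ofReal ((∫ p, ‖f p‖ ^ 2 ∂(ptMeasure d)) ^ k) := by
      have e := integral_fintype_prod_eq_pow (ι := Fin k) (μ := ptMeasure d) fun p => ‖f p‖ ^ 2
      rw [Fintype.card_fin] at e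
      rw [← e, ofReal_integral_eq_lintegral_ofReal hi
        (Eventually.of_forall fun x => Finset.prod_nonneg fun i _ => sq_nonneg _)]
      refine lintegral_congr fun x => ?_
      rw [Real.enorm_eq_ofReal (sq_nonneg _)]
      simp only [coh, confMk, Finset.prod_pow, norm_prod]
      rfl
    rw [h1, div_eq_inv_mul, ENNReal.ofReal_mul (by positivity),
      ENNReal.ofReal_inv_of_pos (by positivity), ENNReal.ofReal_natCast, smul_eq_mul]
  have hA : (0 : ℝ) ≤ ∫ p, ‖f p‖ ^ 2 ∂(ptMeasure d) := integral_nonneg fun _ => sq_nonneg _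
  simp_rw [hk]
  rw [← ENNReal.ofReal_tsum_of_nonneg (fun k => by positivity)
    (Real.summable_pow_div_factorial _)]
  exact ENNReal.ofReal_lt_top

/-- The vector `ξ ⊗ f^⊗`, as an `H`-valued function on configurations. -/
def cohVec {d : ℕ} {H : Type*} [NormedAddCommGroup H] [InnerProductSpace ℂ H]
    (f : TestFn d) (ξ : H) : Lp H 2 (confMeasure d) :=
  ((ContinuousLinearMap.toSpanSingleton ℂ ξ).comp_memLp' (coh_memLp f.2)).toLp
    ((ContinuousLinearMap.toSpanSingleton ℂ ξ) ∘ coh f.1)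

/-- The `H`-span `𝓓` of the coherent functions. -/
def CohSpan (d : ℕ) (H : Type*) [NormedAddCommGroup H] [InnerProductSpace ℂ H] :
    Submodule ℂ (Lp H 2 (confMeasure d)) :=
  Submodule.span ℂ {ψ | ∃ (f : TestFn d) (ξ : H), ψ = cohVec f ξ}

/-- The vector `ξ ⊗ f^⊗` as an element of `𝓓`. -/
def cohD {d : ℕ} {H : Type*} [NormedAddCommGroup H] [InnerProductSpace ℂ H]
    (f : TestFn d) (ξ : H) : CohSpan d H :=
  ⟨cohVec f ξ, Submodule.subset_span ⟨f, ξ, rfl⟩⟩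

/-- `𝓓`-forms: sesquilinear forms on `𝓓`, conjugate-linear in the first argument. -/
abbrev DForm (d : ℕ) (H : Type*) [NormedAddCommGroup H] [InnerProductSpace ℂ H] : Type _ :=
  CohSpan d H →ₗ⋆[ℂ] CohSpan d H →ₗ[ℂ] ℂ

/-- The scalar product `⟨f^⊗ | h^⊗⟩` in Fock space. -/
def cohInner {d : ℕ} (f h : TestFn d) : ℂ :=
  ∫ τ, star (coh f.1 τ) * coh h.1 τ ∂(confMeasure d)

/-! ### The standard integrators -/

/-- The integrators `Λ_μ^ν(t)` acting on functions of configurations: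
`Λ_-^+(t) = t`, annihilation `Λ_-^n(t)`, creation `Λ_m^+(t)`, and exchange (number) `Λ_m^n(t)`,
which replaces a point `(s, m)`, `s < t`, of the argument by `(s, n)`. -/
def noiseOp {d : ℕ} (t : ℝ) : NoiseIdx d → NoiseIdx d → (Conf d → ℂ) → Conf d → ℂ
  | none, none, ψ, τ => (t : ℂ) * ψ τ
  | none, some n, ψ, ⟨k, x⟩ => ∫ s in Set.Ico 0 t, ψ ⟨k + 1, Fin.cons (s, n) x⟩
  | some _, none, _, ⟨0, _⟩ => 0
  | some m, none, ψ, ⟨k + 1, x⟩ =>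
      ∑ i : Fin (k + 1), if (x i).2 = m ∧ (x i).1 < t then ψ ⟨k, i.removeNth x⟩ else 0
  | some m, some n, ψ, ⟨k, x⟩ =>
      ∑ i : Fin k, if (x i).2 = m ∧ (x i).1 < t then
        ψ ⟨k, Function.update x i ((x i).1, n)⟩ else 0

/-- The matrix element `⟨f^⊗ | Λ_μ^ν(t) h^⊗⟩`. -/
def noiseElem {d : ℕ} (μ ν : NoiseIdx d) (t : ℝ) (f h : TestFn d) : ℂ :=
  ∫ τ, star (coh f.1 τ) * noiseOp t μ ν (coh h.1) τ ∂(confMeasure d)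

/-! ### Adapted forms and quantum stochastic integrals -/

section Integral

variable {d : ℕ} {H : Type*} [NormedAddCommGroup H] [InnerProductSpace ℂ H]

/-- A form is adapted at time `s` if it is the product of a form on the Fock space of `[0, s)` and
the identity of the Fock space of `[s, ∞)`. -/
def IsAdaptedAt (s : ℝ) (X : DForm d H) : Prop :=
  ∀ (f h : TestFn d) (ξ η : H), X (cohD f ξ) (cohD h η) =
    X (cohD (f.past s) ξ) (cohD (h.past s) η) * cohInner (f.future s) (h.future s)

/-- The matrix element of `X · (Λ_μ^ν(t') - Λ_μ^ν(t))` between `ξ ⊗ f^⊗` and `η ⊗ h^⊗`, for `X`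
adapted at `s ≤ t ≤ t'`: the product of the form `X` on the Fock space of `[0, s)` and the increment
on the Fock space of `[s, ∞)`. -/
def itoTerm (μ ν : NoiseIdx d) (X : DForm d H) (s t t' : ℝ) (f h : TestFn d) (ξ η : H) : ℂ :=
  X (cohD (f.past s) ξ) (cohD (h.past s) η) *
    (noiseElem μ ν t' (f.future s) (h.future s) - noiseElem μ ν t (f.future s) (h.future s))

/-- A simple adapted process, equal to `val i` on `[time i, time (i + 1))`, `i < num`, and to zero
elsewhere. -/
structure SimpleProcess (d : ℕ) (H : Type*) [NormedAddCommGroup H] [InnerProductSpace ℂ H] where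
  num : ℕ
  time : ℕ → ℝ
  time_mono : Monotone time
  time_zero : 0 ≤ time 0
  val : ℕ → DForm d H
  adapted : ∀ i, IsAdaptedAt (time i) (val i)

/-- The value at time `s` of a simple process. -/
def SimpleProcess.at (S : SimpleProcess d H) (s : ℝ) : DForm d H :=
  ∑ i ∈ Finset.range S.num, if S.time i ≤ s ∧ s < S.time (i + 1) then S.val i else 0

/-- The matrix elements of `∫_0^t S dΛ_μ^ν = ∑_i S_{t_i} (Λ_μ^ν(t ∧ t_{i+1}) - Λ_μ^ν(t ∧ t_i))`. -/
def SimpleProcess.integral (S : SimpleProcess d H) (μ ν : NoiseIdx d) (t : ℝ)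
    (f h : TestFn d) (ξ η : H) : ℂ :=
  ∑ i ∈ Finset.range S.num,
    itoTerm μ ν (S.val i) (S.time i) (min t (S.time i)) (min t (S.time (i + 1))) f h ξ η

/-- `Z_t = ∫_0^t X_s dΛ_μ^ν(s)` for all `t ≥ 0`: there are simple adapted processes which
approximate `X` and whose stochastic integrals converge to `Z`, in every matrix element between
coherent vectors `ξ ⊗ f^⊗` and `η ⊗ h^⊗`. -/
def IsQSIntegral (μ ν : NoiseIdx d) (X Z : ℝ → DForm d H) : Prop :=
  ∃ S : ℕ → SimpleProcess d H, ∀ (f h : TestFn d) (ξ η : H),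
    AEStronglyMeasurable (fun s => X s (cohD f ξ) (cohD h η)) (volume.restrict (Set.Ici 0)) ∧
    ∀ t : ℝ, 0 ≤ t →
      Tendsto (fun n => ∫⁻ s in Set.Ico 0 t,
        ‖(S n).at s (cohD f ξ) (cohD h η) - X s (cohD f ξ) (cohD h η)‖ₑ *
          (‖f.comp μ s‖ₑ * ‖h.comp ν s‖ₑ)) atTop (𝓝 0) ∧
      Tendsto (fun n => (S n).integral μ ν t f h ξ η) atTop
        (𝓝 (Z t (cohD f ξ) (cohD h η)))

end Integral

/-! ### Quantum stochastic evolutions over an operator algebra -/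

section Evolution

variable {d : ℕ} {H : Type*} [NormedAddCommGroup H] [InnerProductSpace ℂ H] [CompleteSpace H]
  {𝓑 : StarSubalgebra ℂ (H →L[ℂ] H)}

/-- `φ` is an adapted solution of `dφ_t(Y) = ∑_{μ,ν} φ_t(λ_ν^μ(Y)) dΛ_μ^ν`, `φ_0(Y) = Y ⊗ 1`,
for all `Y ∈ 𝓑`. Here `lam μ ν` is `λ_ν^μ`. -/
structure IsQSSolution (lam : NoiseIdx d → NoiseIdx d → 𝓑 →ₗ[ℂ] 𝓑)
    (φ : ℝ → 𝓑 →ₗ[ℂ] DForm d H) : Prop where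
  adapted : ∀ t : ℝ, 0 ≤ t → ∀ Y : 𝓑, IsAdaptedAt t (φ t Y)
  initial : ∀ (Y : 𝓑) (χ ψ : CohSpan d H),
    φ 0 Y χ ψ = inner ℂ (χ : Lp H 2 (confMeasure d))
      ((Y : H →L[ℂ] H).compLp (ψ : Lp H 2 (confMeasure d)))
  equation : ∀ Y : 𝓑, ∃ Z : NoiseIdx d → NoiseIdx d → ℝ → DForm d H,
    (∀ μ ν, IsQSIntegral μ ν (fun s => φ s (lam μ ν Y)) (Z μ ν)) ∧
    ∀ t : ℝ, 0 ≤ t → φ t Y = φ 0 Y + ∑ μ, ∑ ν, Z μ ν t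

/-- Complete positivity of a map from `𝓑` into the `𝓓`-forms. -/
def IsCPForm (Φ : 𝓑 →ₗ[ℂ] DForm d H) : Prop :=
  ∀ (N : ℕ) (B : Fin N → 𝓑) (ψ : Fin N → CohSpan d H),
    0 ≤ ∑ k, ∑ l, Φ (star (B k) * B l) (ψ k) (ψ l)

/-- The Hilbert space `H ⊕ (H ⊗ ℂ^d)`, with vectors `η = (η^μ)`; the summand `H` has index
`none`. -/
abbrev ExtSpace (d : ℕ) (H : Type*) [NormedAddCommGroup H] [InnerProductSpace ℂ H] : Type _ :=
  PiLp 2 fun _ : NoiseIdx d => H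

/-- The operator on `H ⊕ (H ⊗ ℂ^d)` with matrix elements `A μ ν`:
`(A η)^μ = ∑_ν A μ ν η^ν`. -/
def blockOp (A : NoiseIdx d → NoiseIdx d → H →L[ℂ] H) : ExtSpace d H →L[ℂ] ExtSpace d H :=
  ((PiLp.continuousLinearEquiv 2 ℂ fun _ : NoiseIdx d => H).symm :
      (NoiseIdx d → H) →L[ℂ] ExtSpace d H) ∘L
    ContinuousLinearMap.pi fun μ => ∑ ν, A μ ν ∘L PiLp.proj 2 (fun _ : NoiseIdx d => H) ν

/-- The germ map `γ = λ + δ`: `γ_+^- = λ_+^-`, `γ_+^m = λ_+^m`, `γ_n^- = λ_n^-`,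
`γ_n^m(B) = λ_n^m(B) + B δ_n^m`. -/
def germ (lam : NoiseIdx d → NoiseIdx d → 𝓑 →ₗ[ℂ] 𝓑) (B : 𝓑) :
    ExtSpace d H →L[ℂ] ExtSpace d H :=
  blockOp fun μ ν => (lam μ ν B : H →L[ℂ] H) +
    if μ = ν ∧ μ ≠ none then (B : H →L[ℂ] H) else 0

/-- The degenerate representation `ι(B) = B ⊕ 0` of `𝓑` on `H ⊕ (H ⊗ ℂ^d)`. -/
def iotaRep (d : ℕ) (B : 𝓑) : ExtSpace d H →L[ℂ] ExtSpace d H :=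
  blockOp fun μ ν => if μ = none ∧ ν = none then (B : H →L[ℂ] H) else 0

end Evolution

end

/-! ### Integrals over configurations -/

/-! The germ map is the right derivative at time zero of the solution, taken between test vectors
that themselves shrink with time. Between coherent vectors a stochastic integral is an ordinary time
integral against `conj f^μ(s) h^ν(s)` (`noiseElem_eq`, `IsQSIntegral.eq_integral`), so the equation
turns into a system of integral equations for matrix elements.

Take `f = a 1_{[0,1)}` and `h = b 1_{[0,1)}`, so that the densities are constant on `[0,1)`. The
matrix elements of `φ_t(Y)` are then right differentiable at zero, with the `λ^μ_ν(Y)` in the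
derivative. Replacing `f`, `h` by their restrictions to `[0,t)` divides, by adaptedness, by the
overlap `exp((1-t)⟨a|b⟩)` of the futures; differentiating this factor produces exactly the extra
term `δ^m_n Y`. The result is `∑ conj(a^μ) b^ν ⟨ξ|γ^μ_ν(Y)η⟩` with `a^- = b^+ = 1`
(`IsQSSolution.hasDerivWithinAt_past`).

The vectors `1 ⊕ a` with `a = 0, e_1, …, e_d` form a basis of `ℂ^(1+d)`. Hence suitable sums
`germVec t ζ` of coherent vectors yield the derivative `⟨ζ|γ(Y)ζ'⟩` for arbitrary `ζ`, `ζ'`, while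
the value at `t = 0` is `⟨ζ^0|Yζ'^0⟩`. The form in the complete positivity condition, evaluated on
`germVec t (η_k)`, is nonnegative for `t > 0` and equals `‖∑ B_k η_k^0‖² = 0` at `t = 0`, so its
right derivative is nonnegative. Symmetry follows in the same way from the hermiticity of completely
positive maps (`IsCPForm.hermitian`). -/

theorem integrable_confMeasure {d : ℕ} {F : Conf d → ℂ}
    (hF : ∀ k, Integrable (fun x => F (confMk d k x)) (Measure.pi fun _ : Fin k => ptMeasure d))
    {b : ℕ → ℝ} (hb : Summable b)
    (hFb : ∀ k, (k.factorial : ℝ)⁻¹ *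
      ∫ x, ‖F (confMk d k x)‖ ∂(Measure.pi fun _ : Fin k => ptMeasure d) ≤ b k) :
    Integrable F (confMeasure d) := by
  have hfac : ∀ k : ℕ, (k.factorial : ℝ≥0∞)⁻¹ ≠ ∞ := fun k => by
    simp [Nat.factorial_ne_zero]
  refine integrable_sum_measure (fun k => ?_) ?_
  · rw [(measurableEmbedding_conf d k).integrable_map_iff]
    exact (hF k).smul_measure (hfac k)
  · refine Summable.of_nonneg_of_le (fun k => integral_nonneg fun _ => norm_nonneg _) (fun k => ?_) hb
    rw [(measurableEmbedding_conf d k).integral_map, integral_smul_measure]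
    simpa using hFb k

theorem hasSum_integral_confMeasure {d : ℕ} {F : Conf d → ℂ} (hF : Integrable F (confMeasure d)) :
    HasSum (fun k : ℕ => (k.factorial : ℂ)⁻¹ *
      ∫ x, F (confMk d k x) ∂(Measure.pi fun _ : Fin k => ptMeasure d))
      (∫ τ, F τ ∂(confMeasure d)) := by
  have h := hasSum_integral_measure hF
  have hk : ∀ k : ℕ, ∫ τ, F τ ∂((((k.factorial : ℝ≥0∞)⁻¹) •
      Measure.pi fun _ : Fin k => ptMeasure d).map (confMk d k)) = (k.factorial : ℂ)⁻¹ *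
      ∫ x, F (confMk d k x) ∂(Measure.pi fun _ : Fin k => ptMeasure d) := fun k => by
    rw [(measurableEmbedding_conf d k).integral_map, integral_smul_measure]
    simp [Complex.real_smul]
  simp only [hk] at h
  exact h

theorem hasSum_exp_factorial (c : ℂ) :
    HasSum (fun k : ℕ => (k.factorial : ℂ)⁻¹ * c ^ k) (Complex.exp c) := by
  have := NormedSpace.expSeries_div_hasSum_exp c
  rw [← Complex.exp_eq_exp_ℂ] at this
  simpa [div_eq_inv_mul] using this

/-- `∑_i v(x_i) ∏_{j ≠ i} w(x_j)`. -/
noncomputable def markedProd {d : ℕ} (v w : Pt d → ℂ) : Conf d → ℂ :=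
  fun τ => ∑ i, ∏ j, if j = i then v (τ.2 j) else w (τ.2 j)

theorem coh_confMk {d k : ℕ} (w : Pt d → ℂ) (x : Fin k → Pt d) :
    coh w (confMk d k x) = ∏ i : Fin k, w (x i) := rfl

theorem markedProd_confMk {d k : ℕ} (v w : Pt d → ℂ) (x : Fin k → Pt d) :
    markedProd v w (confMk d k x) = ∑ i : Fin k, ∏ j : Fin k, if j = i then v (x j) else w (x j) :=
  rfl

theorem integral_prod_ptMeasure {𝕜 : Type*} [RCLike 𝕜] {d : ℕ} (w : Pt d → 𝕜) (k : ℕ) :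
    ∫ x : Fin k → Pt d, ∏ i, w (x i) ∂(Measure.pi fun _ : Fin k => ptMeasure d) =
      (∫ p, w p ∂(ptMeasure d)) ^ k := by
  rw [integral_fintype_prod_eq_pow, Fintype.card_fin]

theorem integral_coh {d : ℕ} {w : Pt d → ℂ} (hw : Integrable w (ptMeasure d)) :
    ∫ τ, coh w τ ∂(confMeasure d) = Complex.exp (∫ p, w p ∂(ptMeasure d)) := by
  have hi : Integrable (coh w) (confMeasure d) := by
    refine integrable_confMeasure (fun k => ?_)
      (Real.summable_pow_div_factorial (∫ p, ‖w p‖ ∂(ptMeasure d))) (fun k => ?_)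
    · simp only [coh_confMk]
      exact Integrable.fintype_prod fun _ => hw
    simp only [coh_confMk, norm_prod, integral_prod_ptMeasure fun p => ‖w p‖, div_eq_inv_mul, le_refl]
  have h := hasSum_integral_confMeasure hi
  simp only [coh_confMk, integral_prod_ptMeasure] at h
  exact h.unique (hasSum_exp_factorial _)

theorem integrable_markedTerm {d k : ℕ} {v w : Pt d → ℂ} (hv : Integrable v (ptMeasure d))
    (hw : Integrable w (ptMeasure d)) (i : Fin k) :
    Integrable (fun x : Fin k → Pt d => ∏ j, if j = i then v (x j) else w (x j))
      (Measure.pi fun _ : Fin k => ptMeasure d) := by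
  refine Integrable.fintype_prod (f := fun j p => if j = i then v p else w p) fun j => ?_
  by_cases h : j = i <;> simp [h, hv, hw]

theorem integral_markedTerm {𝕜 : Type*} [RCLike 𝕜] {d k : ℕ} (v w : Pt d → 𝕜) (i : Fin k) :
    ∫ x : Fin k → Pt d, (∏ j, if j = i then v (x j) else w (x j))
      ∂(Measure.pi fun _ : Fin k => ptMeasure d)
      = (∫ p, v p ∂(ptMeasure d)) * (∫ p, w p ∂(ptMeasure d)) ^ (k - 1) := by
  rw [integral_fintype_prod_eq_prod (f := fun j p => if j = i then v p else w p)]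
  rw [← Finset.mul_prod_erase _ _ (Finset.mem_univ i)]
  rw [Finset.prod_congr rfl (g := fun _ => ∫ p, w p ∂(ptMeasure d))]
  · simp
  · intro j hj
    simp [Finset.ne_of_mem_erase hj]

/-- Since `k / k! = 1 / (k-1)!`, this is the exponential series shifted by one; the term `k = 0`
vanishes, so the truncated exponent there is harmless. The real case serves as the dominating
series, the complex case gives the value of the integral. -/
theorem hasSum_marked_factorial {𝕜 : Type*} [RCLike 𝕜] (V W E : 𝕜)
    (h : HasSum (fun k : ℕ => (k.factorial : 𝕜)⁻¹ * W ^ k) E) :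
    HasSum (fun k : ℕ => (k.factorial : 𝕜)⁻¹ * (k * (V * W ^ (k - 1)))) (V * E) := by
  rw [← hasSum_nat_add_iff' 1]
  simp only [Finset.sum_range_one, Nat.cast_zero, zero_mul, mul_zero, sub_zero]
  refine (h.mul_left V).congr_fun fun k => ?_
  have : (k.factorial : 𝕜) ≠ 0 := by exact_mod_cast Nat.factorial_ne_zero k
  have h2 : ((k : 𝕜) + 1) ≠ 0 := by exact_mod_cast Nat.succ_ne_zero k
  simp only [Nat.factorial_succ, Nat.add_sub_cancel]
  push_cast
  field_simp

/-- By Fubini each of the `k` choices of the marked point contributes `V W^(k-1)` on the `k`-point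
sector, where `V`, `W` are the integrals of `v`, `w`. Integrability follows from the same series for
`‖v‖` and `‖w‖`. -/
theorem integral_markedProd {d : ℕ} {v w : Pt d → ℂ} (hv : Integrable v (ptMeasure d))
    (hw : Integrable w (ptMeasure d)) :
    ∫ τ, markedProd v w τ ∂(confMeasure d) =
      (∫ p, v p ∂(ptMeasure d)) * Complex.exp (∫ p, w p ∂(ptMeasure d)) := by
  have hterm := fun k => integrable_markedTerm (k := k) hv hw
  have hi : Integrable (markedProd v w) (confMeasure d) := by
    have hs : HasSum (fun k : ℕ => (k.factorial : ℝ)⁻¹ * (∫ p, ‖w p‖ ∂(ptMeasure d)) ^ k)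
        (∑' k : ℕ, (k.factorial : ℝ)⁻¹ * (∫ p, ‖w p‖ ∂(ptMeasure d)) ^ k) := by
      refine Summable.hasSum ?_
      simpa [div_eq_inv_mul] using
        Real.summable_pow_div_factorial (∫ p, ‖w p‖ ∂(ptMeasure d))
    refine integrable_confMeasure (fun k => ?_)
      (hasSum_marked_factorial (∫ p, ‖v p‖ ∂(ptMeasure d)) _ _ hs).summable (fun k => ?_)
    · simp only [markedProd_confMk]
      exact integrable_finsetSum _ fun i _ => hterm k i
    simp only [markedProd_confMk]
    refine mul_le_mul_of_nonneg_left ?_ (by positivity)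
    calc ∫ x : Fin k → Pt d, ‖∑ i : Fin k, ∏ j, if j = i then v (x j) else w (x j)‖ ∂(Measure.pi fun _ : Fin k => ptMeasure d)
        ≤ ∫ x : Fin k → Pt d, ∑ i, ‖∏ j, if j = i then v (x j) else w (x j)‖
          ∂(Measure.pi fun _ : Fin k => ptMeasure d) :=
          integral_mono (integrable_finsetSum _ fun i _ => hterm k i).norm
            (integrable_finsetSum _ fun i _ => (hterm k i).norm) fun x => norm_sum_le _ _
      _ = _ := by
        rw [integral_finsetSum _ fun i _ => (hterm k i).norm]
        simp only [norm_prod, apply_ite norm]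
        simp [integral_markedTerm (fun p => ‖v p‖) (fun p => ‖w p‖)]
  refine (hasSum_integral_confMeasure hi).unique ?_
  have hk : ∀ k : ℕ, ∫ x, markedProd v w (confMk d k x)
      ∂(Measure.pi fun _ : Fin k => ptMeasure d) =
      k * ((∫ p, v p ∂(ptMeasure d)) * (∫ p, w p ∂(ptMeasure d)) ^ (k - 1)) := fun k => by
    simp only [markedProd_confMk]
    rw [integral_finsetSum _ fun i _ => hterm k i]
    simp [integral_markedTerm v w]
  simp only [hk]
  exact hasSum_marked_factorial _ _ _ (hasSum_exp_factorial _)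

/-! ### One-particle integrals -/

theorem ptMeasure_eq_sum (d : ℕ) : ptMeasure d = Measure.sum fun n : Fin d =>
    ((volume : Measure ℝ).restrict (Set.Ici 0)).map fun s => (s, n) := by
  unfold ptMeasure Measure.count
  rw [Measure.prod_sum_right]
  simp only [Measure.prod_dirac]

theorem measurableEmbedding_pt {d : ℕ} (n : Fin d) :
    MeasurableEmbedding fun s : ℝ => ((s, n) : Pt d) :=
  measurableEmbedding_prod_mk_right n

theorem integrable_ptMeasure_iff {d : ℕ} {v : Pt d → ℂ} : Integrable v (ptMeasure d) ↔
    ∀ n, IntegrableOn (fun s => v (s, n)) (Set.Ici 0) := by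
  rw [ptMeasure_eq_sum, integrable_sum_measure_iff,
    and_iff_left (summable_of_hasFiniteSupport (Set.toFinite _))]
  simp [(measurableEmbedding_pt _).integrable_map_iff, IntegrableOn, Function.comp_def]

theorem integral_ptMeasure {d : ℕ} {v : Pt d → ℂ} (hv : Integrable v (ptMeasure d)) :
    ∫ p, v p ∂(ptMeasure d) = ∑ n, ∫ s in Set.Ici 0, v (s, n) := by
  rw [ptMeasure_eq_sum] at hv ⊢
  rw [integral_sum_measure hv, tsum_fintype]
  simp [(measurableEmbedding_pt _).integral_map]

theorem TestFn.memLp_slice {d : ℕ} (f : TestFn d) (n : Fin d) :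
    MemLp (fun s => f.1 (s, n)) 2 (volume.restrict (Set.Ici 0)) := by
  have h : MemLp f.1 2 (ptMeasure d) := f.2
  generalize f.1 = g at h ⊢
  rw [ptMeasure_eq_sum] at h
  have h2 := h.mono_measure (Measure.le_sum _ n)
  rwa [(measurableEmbedding_pt n).memLp_map_measure_iff] at h2

theorem TestFn.memLp_comp {d : ℕ} (f : TestFn d) (μ : NoiseIdx d) (t : ℝ) :
    MemLp (f.comp μ) 2 (volume.restrict (Set.Ico 0 t)) := by
  cases μ with
  | none => exact memLp_const 1
  | some n =>
    exact (f.memLp_slice n).mono_measure (Measure.restrict_mono Set.Ico_subset_Ici_self le_rfl)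

/-- The density `conj f^μ(s) h^ν(s)`. -/
noncomputable def noiseDensity {d : ℕ} (μ ν : NoiseIdx d) (f h : TestFn d) (s : ℝ) : ℂ :=
  star (f.comp μ s) * h.comp ν s

theorem integrableOn_noiseDensity {d : ℕ} (μ ν : NoiseIdx d) (f h : TestFn d) (t : ℝ) :
    IntegrableOn (noiseDensity μ ν f h) (Set.Ico 0 t) :=
  (f.memLp_comp μ t).star.integrable_mul (h.memLp_comp ν t)

theorem integrable_overlap {d : ℕ} (f h : TestFn d) :
    Integrable (fun p => star (f.1 p) * h.1 p) (ptMeasure d) :=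
  f.2.star.integrable_mul h.2

theorem star_coh_mul {d : ℕ} (f h : Pt d → ℂ) (τ : Conf d) :
    star (coh f τ) * coh h τ = coh (fun p => star (f p) * h p) τ := by
  simp [coh, Finset.prod_mul_distrib]

theorem cohInner_eq {d : ℕ} (f h : TestFn d) :
    cohInner f h = Complex.exp (∫ p, star (f.1 p) * h.1 p ∂(ptMeasure d)) := by
  simp only [cohInner, star_coh_mul]
  exact integral_coh (integrable_overlap f h)

/-- A function on `[0, t)`, placed at the degree of freedom `m`. -/
noncomputable def slicePt {d : ℕ} (t : ℝ) (m : Fin d) (g : ℝ → ℂ) (p : Pt d) : ℂ :=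
  if p.2 = m ∧ p.1 < t then g p.1 else 0

theorem slicePt_slice {d : ℕ} (t : ℝ) (m n : Fin d) (g : ℝ → ℂ) :
    (fun s => slicePt t m g (s, n)) = (Set.Iio t).indicator (if n = m then g else 0) := by
  ext s
  by_cases h : n = m <;> by_cases h' : s < t <;> simp [slicePt, h, h']

theorem Iio_inter_Ici_zero (t : ℝ) : Set.Iio t ∩ Set.Ici 0 = Set.Ico 0 t := by
  rw [Set.inter_comm, Set.Ici_inter_Iio]

theorem integrable_slicePt {d : ℕ} {t : ℝ} {m : Fin d} {g : ℝ → ℂ}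
    (hg : IntegrableOn g (Set.Ico 0 t)) : Integrable (slicePt t m g) (ptMeasure d) := by
  rw [integrable_ptMeasure_iff]
  intro n
  rw [slicePt_slice, IntegrableOn, integrable_indicator_iff measurableSet_Iio, IntegrableOn,
    Measure.restrict_restrict measurableSet_Iio, Iio_inter_Ici_zero]
  split_ifs
  · exact hg
  · exact integrable_zero _ _ _

theorem integral_slicePt {d : ℕ} {t : ℝ} {m : Fin d} {g : ℝ → ℂ}
    (hg : IntegrableOn g (Set.Ico 0 t)) :
    ∫ p, slicePt t m g p ∂(ptMeasure d) = ∫ s in Set.Ico 0 t, g s := by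
  rw [integral_ptMeasure (integrable_slicePt hg)]
  rw [Finset.sum_eq_single m]
  · rw [slicePt_slice, integral_indicator measurableSet_Iio,
      Measure.restrict_restrict measurableSet_Iio, Iio_inter_Ici_zero, if_pos rfl]
  · intro n _ hn
    rw [slicePt_slice, if_neg hn]
    simp
  · simp

/-- Creation removes the point `x_i` from the argument of `h^⊗`, leaving its factor `conj f(x_i)`
without partner. This lone factor is the marked one; all other points carry `conj f h`. -/
theorem star_coh_mul_creation {d : ℕ} (t : ℝ) (m : Fin d) (f h : TestFn d) (τ : Conf d) :
    star (coh f.1 τ) * noiseOp t (some m) none (coh h.1) τ =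
      markedProd (slicePt t m (noiseDensity (some m) none f h))
        (fun p => star (f.1 p) * h.1 p) τ := by
  obtain ⟨k, x⟩ := τ
  cases k with
  | zero => simp [noiseOp, markedProd]
  | succ k =>
    simp only [noiseOp, markedProd, Finset.mul_sum]
    refine Finset.sum_congr rfl fun i _ => ?_
    rw [Fin.prod_univ_succAbove _ i]
    simp only [if_true, Fin.succAbove_ne, if_false, slicePt, coh]
    rw [Fin.prod_univ_succAbove _ i]
    split_ifs with hi
    · simp only [Finset.prod_mul_distrib, star_mul', star_prod, noiseDensity, TestFn.comp, mul_one,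
        Fin.removeNth_apply]
      rw [← hi.1]
      ring
    · simp

/-- Only the factor at `x_i` changes: there `h^m` becomes `h^n`, which makes `x_i` the marked point.
-/
theorem star_coh_mul_exchange {d : ℕ} (t : ℝ) (m n : Fin d) (f h : TestFn d) (τ : Conf d) :
    star (coh f.1 τ) * noiseOp t (some m) (some n) (coh h.1) τ =
      markedProd (slicePt t m (noiseDensity (some m) (some n) f h))
        (fun p => star (f.1 p) * h.1 p) τ := by
  obtain ⟨k, x⟩ := τ
  simp only [noiseOp, markedProd, Finset.mul_sum]
  refine Finset.sum_congr rfl fun i _ => ?_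
  split_ifs with hi
  · simp only [coh, star_prod, ← Finset.prod_mul_distrib]
    refine Finset.prod_congr rfl fun j _ => ?_
    split_ifs with hj
    · subst hj
      rw [Function.update_self, slicePt, if_pos hi]
      simp only [noiseDensity, TestFn.comp, ← hi.1]
    · rw [Function.update_of_ne hj]
  · rw [mul_zero]
    refine (Finset.prod_eq_zero (Finset.mem_univ i) ?_).symm
    simp [slicePt, hi]

/-- Coherent vectors are eigenvectors of annihilation, which settles the case of an upper index `-`.
Creation and exchange turn the integrand into a marked product, whose integral splits off the
exponential `⟨f^⊗|h^⊗⟩`. -/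
theorem noiseElem_eq {d : ℕ} (μ ν : NoiseIdx d) {t : ℝ} (ht : 0 ≤ t) (f h : TestFn d) :
    noiseElem μ ν t f h = (∫ s in Set.Ico 0 t, noiseDensity μ ν f h s) * cohInner f h := by
  have hd := integrableOn_noiseDensity μ ν f h t
  match μ, ν with
  | none, none =>
    have : ∀ τ, star (coh f.1 τ) * noiseOp t none none (coh h.1) τ
        = t * (star (coh f.1 τ) * coh h.1 τ) := fun τ => by simp only [noiseOp]; ring
    simp only [noiseElem, this, integral_const_mul, cohInner]
    simp [noiseDensity, TestFn.comp, ht]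
  | none, some n =>
    have : ∀ τ, star (coh f.1 τ) * noiseOp t none (some n) (coh h.1) τ
        = (∫ s in Set.Ico 0 t, noiseDensity none (some n) f h s) *
          (star (coh f.1 τ) * coh h.1 τ) := fun ⟨k, x⟩ => by
      simp only [noiseOp, coh, Fin.prod_univ_succ, Fin.cons_zero, Fin.cons_succ,
        integral_mul_const, noiseDensity, TestFn.comp, star_one, one_mul]
      ring
    simp only [noiseElem, this, integral_const_mul, cohInner]
  | some m, none =>
    simp only [noiseElem, star_coh_mul_creation]
    rw [integral_markedProd (integrable_slicePt hd) (integrable_overlap f h),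
      integral_slicePt hd, cohInner_eq]
  | some m, some n =>
    simp only [noiseElem, star_coh_mul_exchange]
    rw [integral_markedProd (integrable_slicePt hd) (integrable_overlap f h),
      integral_slicePt hd, cohInner_eq]

/-! ### Stochastic integrals as time integrals -/

theorem TestFn.comp_future {d : ℕ} (f : TestFn d) (μ : NoiseIdx d) {r s : ℝ} (h : r ≤ s) :
    (f.future r).comp μ s = f.comp μ s := by
  cases μ with
  | none => rfl
  | some n => simp [TestFn.comp, TestFn.future, h]

section TimeIntegral

variable {d : ℕ} {H : Type*} [NormedAddCommGroup H] [InnerProductSpace ℂ H]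

/-- The factor `⟨f^⊗|h^⊗⟩` of the futures, contained in both noise elements, recombines by
adaptedness with the past matrix element of `X` into the full one. The increment only sees times
after `r`, where a function and its future agree. -/
theorem itoTerm_eq {μ ν : NoiseIdx d} {X : DForm d H} {r s s' : ℝ} (hr : 0 ≤ r)
    (hX : IsAdaptedAt r X) (hrs : r ≤ s) (hss : s ≤ s') (f h : TestFn d) (ξ η : H) :
    itoTerm μ ν X r s s' f h ξ η =
      X (cohD f ξ) (cohD h η) * ∫ u in Set.Ico s s', noiseDensity μ ν f h u := by
  have hs : 0 ≤ s := hr.trans hrs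
  rw [itoTerm, noiseElem_eq μ ν (hs.trans hss), noiseElem_eq μ ν hs, hX f h ξ η, ← sub_mul]
  have hi := integrableOn_noiseDensity μ ν (f.future r) (h.future r) s'
  have hsplit : ∫ u in Set.Ico 0 s', noiseDensity μ ν (f.future r) (h.future r) u =
      (∫ u in Set.Ico 0 s, noiseDensity μ ν (f.future r) (h.future r) u) +
      ∫ u in Set.Ico s s', noiseDensity μ ν (f.future r) (h.future r) u := by
    rw [← Set.Ico_union_Ico_eq_Ico hs hss] at hi ⊢
    exact setIntegral_union (Set.Ico_disjoint_Ico_same) measurableSet_Ico hi.left_of_union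
      hi.right_of_union
  have hfut : ∫ u in Set.Ico s s', noiseDensity μ ν (f.future r) (h.future r) u =
      ∫ u in Set.Ico s s', noiseDensity μ ν f h u := by
    refine setIntegral_congr_fun measurableSet_Ico fun u hu => ?_
    simp only [noiseDensity]
    rw [f.comp_future μ (hrs.trans hu.1), h.comp_future ν (hrs.trans hu.1)]
  rw [hsplit, hfut]
  ring

theorem SimpleProcess.at_apply (S : SimpleProcess d H) (s : ℝ) (χ ψ : CohSpan d H) :
    S.at s χ ψ = ∑ i ∈ Finset.range S.num,
      (Set.Ico (S.time i) (S.time (i + 1))).indicator (fun _ => S.val i χ ψ) s := by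
  simp only [SimpleProcess.at, LinearMap.sum_apply, Set.indicator_apply, Set.mem_Ico]
  refine Finset.sum_congr rfl fun i _ => ?_
  split_ifs <;> rfl

theorem SimpleProcess.at_mul (S : SimpleProcess d H) (w : ℝ → ℂ) (χ ψ : CohSpan d H) :
    (fun s => S.at s χ ψ * w s) = fun s => ∑ i ∈ Finset.range S.num,
      (Set.Ico (S.time i) (S.time (i + 1))).indicator (fun s => S.val i χ ψ * w s) s := by
  ext s
  rw [S.at_apply, Finset.sum_mul]
  exact Finset.sum_congr rfl fun i _ => by simp only [Set.indicator_apply, ite_mul, zero_mul]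

theorem SimpleProcess.integrableOn (S : SimpleProcess d H) {w : ℝ → ℂ} {A : Set ℝ}
    (hw : IntegrableOn w A) (χ ψ : CohSpan d H) :
    IntegrableOn (fun s => S.at s χ ψ * w s) A := by
  rw [S.at_mul]
  exact integrable_finsetSum _ fun i _ => (hw.const_mul _).indicator measurableSet_Ico

theorem SimpleProcess.integral_eq (S : SimpleProcess d H) (μ ν : NoiseIdx d) (t : ℝ)
    (f h : TestFn d) (ξ η : H) :
    S.integral μ ν t f h ξ η =
      ∫ s in Set.Ico 0 t, S.at s (cohD f ξ) (cohD h η) * noiseDensity μ ν f h s := by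
  have hw := integrableOn_noiseDensity μ ν f h t
  rw [S.at_mul, integral_finsetSum _ fun i _ => (hw.const_mul _).indicator measurableSet_Ico]
  refine Finset.sum_congr rfl fun i _ => ?_
  have h0 : 0 ≤ S.time i := S.time_zero.trans (S.time_mono (Nat.zero_le i))
  have h1 : S.time i ≤ S.time (i + 1) := S.time_mono (Nat.le_succ i)
  rw [integral_indicator measurableSet_Ico, Measure.restrict_restrict measurableSet_Ico,
    integral_const_mul, Set.Ico_inter_Ico]
  rcases le_total t (S.time i) with hti | hti
  · rw [itoTerm, min_eq_left hti, min_eq_left (hti.trans h1), sub_self,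
      Set.Ico_eq_empty (by simp [hti])]
    simp
  · rw [min_eq_right hti, itoTerm_eq h0 (S.adapted i) le_rfl (le_min hti h1),
      max_eq_left h0, min_comm]

/-- The approximation in the definition is L¹ convergence of the integrands multiplied by the
density, so the time integrals converge as well, and limits are unique. -/
theorem IsQSIntegral.eq_integral {μ ν : NoiseIdx d} {X Z : ℝ → DForm d H}
    (hZ : IsQSIntegral μ ν X Z) (f h : TestFn d) (ξ η : H) {t : ℝ} (ht : 0 ≤ t) :
    IntegrableOn (fun s => X s (cohD f ξ) (cohD h η) * noiseDensity μ ν f h s) (Set.Ico 0 t) ∧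
    Z t (cohD f ξ) (cohD h η) =
      ∫ s in Set.Ico 0 t, X s (cohD f ξ) (cohD h η) * noiseDensity μ ν f h s := by
  obtain ⟨S, hS⟩ := hZ
  obtain ⟨hm, hlim⟩ := hS f h ξ η
  obtain ⟨h1, h2⟩ := hlim t ht
  have hw := integrableOn_noiseDensity μ ν f h t
  have hSi := fun n => (S n).integrableOn hw (cohD f ξ) (cohD h η)
  have hXm : AEStronglyMeasurable
      (fun s => X s (cohD f ξ) (cohD h η) * noiseDensity μ ν f h s)
      (volume.restrict (Set.Ico 0 t)) :=
    (hm.mono_measure (Measure.restrict_mono Set.Ico_subset_Ici_self le_rfl)).mul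
      hw.aestronglyMeasurable
  have henorm : ∀ n s, ‖(S n).at s (cohD f ξ) (cohD h η) * noiseDensity μ ν f h s -
      X s (cohD f ξ) (cohD h η) * noiseDensity μ ν f h s‖ₑ =
      ‖(S n).at s (cohD f ξ) (cohD h η) - X s (cohD f ξ) (cohD h η)‖ₑ *
          (‖f.comp μ s‖ₑ * ‖h.comp ν s‖ₑ) := fun n s => by
    rw [← sub_mul, enorm_mul, noiseDensity, enorm_mul]
    congr 2
    simp [enorm_eq_nnnorm]
  simp only [← henorm] at h1
  have hXi : IntegrableOn (fun s => X s (cohD f ξ) (cohD h η) * noiseDensity μ ν f h s)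
      (Set.Ico 0 t) := by
    -- One approximant at finite L¹ distance already makes the limit integrable.
    obtain ⟨n, hn⟩ := (h1.eventually (gt_mem_nhds zero_lt_one)).exists
    have hdiff : Integrable (fun s => (S n).at s (cohD f ξ) (cohD h η) * noiseDensity μ ν f h s -
      X s (cohD f ξ) (cohD h η) * noiseDensity μ ν f h s) (volume.restrict (Set.Ico 0 t)) :=
      ⟨(hSi n).aestronglyMeasurable.sub hXm, hn.trans ENNReal.one_lt_top⟩
    refine ((hSi n).sub hdiff).congr (Eventually.of_forall fun s => ?_)
    simp
  refine ⟨hXi, tendsto_nhds_unique h2 ?_⟩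
  simp only [fun n => (S n).integral_eq μ ν t f h ξ η]
  exact tendsto_integral_of_L1 _ hXi.aestronglyMeasurable (Eventually.of_forall hSi) h1

theorem coeFn_cohVec (f : TestFn d) (ξ : H) :
    (cohVec f ξ : Conf d → H) =ᵐ[confMeasure d] fun τ => coh f.1 τ • ξ :=
  MemLp.coeFn_toLp _

theorem inner_cohVec_compLp (Y : H →L[ℂ] H) (f h : TestFn d) (ξ η : H) :
    inner ℂ (cohVec f ξ) (Y.compLp (cohVec h η)) = cohInner f h * inner ℂ ξ (Y η) := by
  rw [L2.inner_def, cohInner, ← integral_mul_const]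
  refine integral_congr_ae ?_
  filter_upwards [coeFn_cohVec f ξ, coeFn_cohVec h η, Y.coeFn_compLp (cohVec h η)]
    with τ h1 h2 h3
  rw [h1, h3, h2, map_smul, inner_smul_left, inner_smul_right, mul_assoc]
  rfl

end TimeIntegral

/-! ### Matrix elements of the solution and their continuity at time zero. -/

section Evolution

variable {d : ℕ} {H : Type*} [NormedAddCommGroup H] [InnerProductSpace ℂ H] [CompleteSpace H]
  {𝓑 : StarSubalgebra ℂ (H →L[ℂ] H)} {lam : NoiseIdx d → NoiseIdx d → 𝓑 →ₗ[ℂ] 𝓑}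
  {φ : ℝ → 𝓑 →ₗ[ℂ] DForm d H}

theorem IsQSSolution.initial_coh (hsol : IsQSSolution lam φ) (Y : 𝓑) (f h : TestFn d) (ξ η : H) :
    φ 0 Y (cohD f ξ) (cohD h η) = cohInner f h * inner ℂ ξ ((Y : H →L[ℂ] H) η) := by
  rw [hsol.initial, ← inner_cohVec_compLp]
  rfl

theorem IsQSSolution.integrableOn (hsol : IsQSSolution lam φ) (Y : 𝓑) (μ ν : NoiseIdx d)
    (f h : TestFn d) (ξ η : H) {t : ℝ} (ht : 0 ≤ t) :
    IntegrableOn (fun s => φ s (lam μ ν Y) (cohD f ξ) (cohD h η) * noiseDensity μ ν f h s)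
      (Set.Ico 0 t) := by
  obtain ⟨Z, hZ, -⟩ := hsol.equation Y
  exact ((hZ μ ν).eq_integral f h ξ η ht).1

theorem IsQSSolution.integral_eq (hsol : IsQSSolution lam φ) (Y : 𝓑)
    (f h : TestFn d) (ξ η : H) {t : ℝ} (ht : 0 ≤ t) :
    φ t Y (cohD f ξ) (cohD h η) = φ 0 Y (cohD f ξ) (cohD h η) + ∑ μ, ∑ ν,
      ∫ s in Set.Ico 0 t, φ s (lam μ ν Y) (cohD f ξ) (cohD h η) * noiseDensity μ ν f h s := by
  obtain ⟨Z, hZ, hφ⟩ := hsol.equation Y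
  simp [hφ t ht, LinearMap.sum_apply, fun μ ν => ((hZ μ ν).eq_integral f h ξ η ht).2]

/-- Primitives of integrable functions are continuous. Applied to `λ^μ_ν(Y)` in place of `Y`, this
supplies the continuity of the integrands which the fundamental theorem of calculus needs at zero.
-/
theorem IsQSSolution.continuousWithinAt_zero (hsol : IsQSSolution lam φ) (Y : 𝓑)
    (f h : TestFn d) (ξ η : H) :
    ContinuousWithinAt (fun t => φ t Y (cohD f ξ) (cohD h η)) (Set.Ici 0) 0 := by
  have hint : ∀ μ ν, ContinuousWithinAt (fun t => ∫ s in Set.Ico 0 t,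
      φ s (lam μ ν Y) (cohD f ξ) (cohD h η) * noiseDensity μ ν f h s) (Set.Ici 0) 0 := by
    intro μ ν
    have hi := hsol.integrableOn Y μ ν f h ξ η zero_le_one
    simp only [integral_Ico_eq_integral_Ioc]
    have hc := intervalIntegral.continuousOn_primitive
      ((integrableOn_Icc_iff_integrableOn_Ico).mpr hi)
    exact (hc 0 (by simp)).mono_of_mem_nhdsWithin (Icc_mem_nhdsGE one_pos)
  refine ContinuousWithinAt.congr (f := fun t => φ 0 Y (cohD f ξ) (cohD h η) + ∑ μ, ∑ ν,
      ∫ s in Set.Ico 0 t, φ s (lam μ ν Y) (cohD f ξ) (cohD h η) * noiseDensity μ ν f h s)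
    ?_ (fun t ht => hsol.integral_eq Y f h ξ η ht) (hsol.integral_eq Y f h ξ η le_rfl)
  unfold ContinuousWithinAt at hint ⊢
  exact tendsto_const_nhds.add
    (tendsto_finsetSum _ fun μ _ => tendsto_finsetSum _ fun ν _ => hint μ ν)

end Evolution

/-! ### Step functions -/

theorem memLp_step {d : ℕ} (a : Fin d → ℂ) :
    MemLp ({p : Pt d | p.1 < 1}.indicator fun p => a p.2) 2 (ptMeasure d) := by
  have hs : MeasurableSet {p : Pt d | p.1 < 1} := measurableSet_lt measurable_fst measurable_const
  rw [memLp_indicator_iff_restrict hs]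
  have hfin : ptMeasure d {p : Pt d | p.1 < 1} < ∞ := by
    have : {p : Pt d | p.1 < 1} = Set.Iio 1 ×ˢ Set.univ := by ext p; simp
    rw [this, ptMeasure, Measure.prod_prod, Measure.restrict_apply measurableSet_Iio,
      Iio_inter_Ici_zero]
    simp [Measure.count_apply, Set.encard_univ]
  have : IsFiniteMeasure ((ptMeasure d).restrict {p : Pt d | p.1 < 1}) :=
    ⟨by rwa [Measure.restrict_apply_univ]⟩
  refine MemLp.of_bound ?_ ‖a‖ (Eventually.of_forall fun p => norm_le_pi_norm a p.2)
  exact ((measurable_of_countable a).comp measurable_snd).aestronglyMeasurable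

/-- The function `a 1_{[0,1)}`. -/
noncomputable def stepFn {d : ℕ} (a : Fin d → ℂ) : TestFn d :=
  ⟨{p : Pt d | p.1 < 1}.indicator fun p => a p.2, memLp_step a⟩

/-- The vector `1 ⊕ a`. -/
def extVec {d : ℕ} (a : Fin d → ℂ) : NoiseIdx d → ℂ
  | none => 1
  | some n => a n

theorem comp_stepFn {d : ℕ} (a : Fin d → ℂ) (μ : NoiseIdx d) {s : ℝ} (hs : s < 1) :
    (stepFn a).comp μ s = extVec a μ := by
  cases μ with
  | none => rfl
  | some n => simp [TestFn.comp, stepFn, extVec, hs]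

theorem cohInner_future_stepFn {d : ℕ} (a b : Fin d → ℂ) {t : ℝ} (h0 : 0 ≤ t) (h1 : t ≤ 1) :
    cohInner ((stepFn a).future t) ((stepFn b).future t) =
      Complex.exp ((1 - t) * ∑ n, star (a n) * b n) := by
  rw [cohInner_eq, integral_ptMeasure (integrable_overlap _ _), Finset.mul_sum]
  congr 1
  refine Finset.sum_congr rfl fun n _ => ?_
  have : (fun s => star (((stepFn a).future t).1 (s, n)) * ((stepFn b).future t).1 (s, n)) =
      (Set.Ico t 1).indicator fun _ => star (a n) * b n := by
    ext s
    by_cases hs : t ≤ s <;> by_cases hs' : s < 1 <;>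
      simp [TestFn.future, stepFn, hs, hs']
  rw [this, integral_indicator measurableSet_Ico, Measure.restrict_restrict measurableSet_Ico,
    Set.inter_eq_left.mpr (Set.Ico_subset_Ici_self.trans (Set.Ici_subset_Ici.mpr h0))]
  simp [h1]

theorem cohInner_past_zero {d : ℕ} (f h : TestFn d) :
    cohInner (f.past 0) (h.past 0) = 1 := by
  rw [cohInner_eq, integral_ptMeasure (integrable_overlap _ _), Finset.sum_eq_zero]
  · simp
  · intro n _
    refine setIntegral_eq_zero_of_forall_eq_zero fun s hs => ?_
    simp [TestFn.past, not_lt.mpr (Set.mem_Ici.mp hs)]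

/-- The values of the step functions: zero and the basis vectors of `ℂ^d`. -/
def basisVal {d : ℕ} : NoiseIdx d → Fin d → ℂ
  | none => 0
  | some n => Pi.single n 1

/-- The coefficients of `η` with respect to the vectors `1 ⊕ basisVal i`. -/
def basisCoeff {d : ℕ} {H : Type*} [NormedAddCommGroup H] [InnerProductSpace ℂ H]
    (ζ : ExtSpace d H) : NoiseIdx d → H
  | none => ζ none - ∑ n, ζ (some n)
  | some n => ζ (some n)

/-- Every vector `1 ⊕ e_n` also contributes to the component `none`; the subtraction in `basisCoeff`
compensates for this. -/
theorem sum_extVec_smul_basisCoeff {d : ℕ} {H : Type*} [NormedAddCommGroup H]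
    [InnerProductSpace ℂ H] (ζ : ExtSpace d H) (μ : NoiseIdx d) :
    ∑ i, extVec (basisVal i) μ • basisCoeff ζ i = ζ μ := by
  rw [Fintype.sum_option]
  cases μ with
  | none => simp [extVec, basisCoeff]
  | some m => simp [extVec, basisCoeff, basisVal, Pi.single_apply]

/-! ### The germ map as a right derivative at time zero. -/

section Germ

variable {d : ℕ} {H : Type*} [NormedAddCommGroup H] [InnerProductSpace ℂ H] [CompleteSpace H]
  {𝓑 : StarSubalgebra ℂ (H →L[ℂ] H)} {lam : NoiseIdx d → NoiseIdx d → 𝓑 →ₗ[ℂ] 𝓑}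
  {φ : ℝ → 𝓑 →ₗ[ℂ] DForm d H}

/-- The entries of the germ map. -/
noncomputable def germEntry (lam : NoiseIdx d → NoiseIdx d → 𝓑 →ₗ[ℂ] 𝓑) (μ ν : NoiseIdx d)
    (Y : 𝓑) : H →L[ℂ] H :=
  (lam μ ν Y : H →L[ℂ] H) + if μ = ν ∧ μ ≠ none then (Y : H →L[ℂ] H) else 0

/-- The fundamental theorem of calculus at the left endpoint: on `[0,1)` the densities are constant,
so the integrands inherit right continuity at zero from `φ_s(λ^μ_ν(Y))`. -/
theorem IsQSSolution.hasDerivWithinAt_stepFn (hsol : IsQSSolution lam φ) (Y : 𝓑)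
    (a b : Fin d → ℂ) (ξ η : H) :
    HasDerivWithinAt (fun t => φ t Y (cohD (stepFn a) ξ) (cohD (stepFn b) η))
      (∑ μ, ∑ ν, φ 0 (lam μ ν Y) (cohD (stepFn a) ξ) (cohD (stepFn b) η) *
        (star (extVec a μ) * extVec b ν)) (Set.Ici 0) 0 := by
  have hint : ∀ μ ν, HasDerivWithinAt (fun t => ∫ s in (0 : ℝ)..t,
      φ s (lam μ ν Y) (cohD (stepFn a) ξ) (cohD (stepFn b) η) *
        noiseDensity μ ν (stepFn a) (stepFn b) s)
      (φ 0 (lam μ ν Y) (cohD (stepFn a) ξ) (cohD (stepFn b) η) *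
        (star (extVec a μ) * extVec b ν)) (Set.Ici 0) 0 := by
    intro μ ν
    have hi := hsol.integrableOn Y μ ν (stepFn a) (stepFn b) ξ η zero_le_one
    have hdens : ∀ s : ℝ, s < 1 → noiseDensity μ ν (stepFn a) (stepFn b) s =
        star (extVec a μ) * extVec b ν := fun s hs => by
      rw [noiseDensity, comp_stepFn a μ hs, comp_stepFn b ν hs]
    have hc : ContinuousWithinAt (fun s =>
        φ s (lam μ ν Y) (cohD (stepFn a) ξ) (cohD (stepFn b) η) *
        noiseDensity μ ν (stepFn a) (stepFn b) s) (Set.Ioi 0) 0 := by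
      have h1 : ContinuousWithinAt (fun s =>
        φ s (lam μ ν Y) (cohD (stepFn a) ξ) (cohD (stepFn b) η) *
          (star (extVec a μ) * extVec b ν)) (Set.Ioi 0) 0 :=
        ((hsol.continuousWithinAt_zero (lam μ ν Y) _ _ ξ η).mono Set.Ioi_subset_Ici_self).mul
          continuousWithinAt_const
      refine h1.congr_of_eventuallyEq ?_ (by rw [hdens 0 zero_lt_one])
      filter_upwards [Ioo_mem_nhdsGT (zero_lt_one' ℝ)] with s hs
      rw [hdens s hs.2]
    have := intervalIntegral.integral_hasDerivWithinAt_right (a := 0) (b := 0)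
      (s := Set.Ici 0) (t := Set.Ioi 0) IntervalIntegrable.refl
      ⟨Set.Ico 0 1, Ico_mem_nhdsGT zero_lt_one, hi.aestronglyMeasurable⟩ hc
    rwa [hdens 0 zero_lt_one] at this
  have hsum := (HasDerivWithinAt.fun_sum fun μ (_ : μ ∈ Finset.univ) =>
    HasDerivWithinAt.fun_sum fun ν (_ : ν ∈ Finset.univ) => hint μ ν).const_add
      (φ 0 Y (cohD (stepFn a) ξ) (cohD (stepFn b) η))
  have heq : ∀ t ∈ Set.Ici (0 : ℝ), φ t Y (cohD (stepFn a) ξ) (cohD (stepFn b) η) =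
      φ 0 Y (cohD (stepFn a) ξ) (cohD (stepFn b) η) + ∑ μ, ∑ ν, ∫ s in (0 : ℝ)..t,
        φ s (lam μ ν Y) (cohD (stepFn a) ξ) (cohD (stepFn b) η) *
          noiseDensity μ ν (stepFn a) (stepFn b) s := fun t ht => by
    rw [hsol.integral_eq Y _ _ ξ η ht]
    simp only [integral_Ico_eq_integral_Ioc, intervalIntegral.integral_of_le (Set.mem_Ici.mp ht)]
  exact hsum.congr heq (heq 0 (by simp))

theorem sum_germEntry (Y : 𝓑) (a b : Fin d → ℂ) (ξ η : H) :
    ∑ μ, ∑ ν, star (extVec a μ) * extVec b ν * inner ℂ ξ (germEntry lam μ ν Y η) =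
      (∑ μ, ∑ ν, star (extVec a μ) * extVec b ν * inner ℂ ξ ((lam μ ν Y : H →L[ℂ] H) η)) +
        (∑ n, star (a n) * b n) * inner ℂ ξ ((Y : H →L[ℂ] H) η) := by
  simp only [germEntry, add_apply, inner_add_right, mul_add,
    Finset.sum_add_distrib]
  congr 1
  rw [Fintype.sum_option, Finset.sum_eq_zero, zero_add, Finset.sum_mul]
  · refine Finset.sum_congr rfl fun n _ => ?_
    rw [Finset.sum_eq_single (some n)]
    · simp [extVec]
    · intro ν _ hν
      simp [hν.symm]
    · simp
  · intro ν _
    simp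

/-- By adaptedness the truncated matrix element is the full one divided by the overlap `exp((1-t)c)`
of the futures. The product rule then adds `c ⟨ξ|Yη⟩`, which turns `λ` into `γ`, and the remaining
factors `exp(c)` and `exp(-c)` cancel. -/
theorem IsQSSolution.hasDerivWithinAt_past (hsol : IsQSSolution lam φ) (Y : 𝓑)
    (a b : Fin d → ℂ) (ξ η : H) :
    HasDerivWithinAt
      (fun t => φ t Y (cohD ((stepFn a).past t) ξ) (cohD ((stepFn b).past t) η))
      (∑ μ, ∑ ν, star (extVec a μ) * extVec b ν * inner ℂ ξ (germEntry lam μ ν Y η))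
      (Set.Ici 0) 0 := by
  set c : ℂ := ∑ n, star (a n) * b n with hc
  have hE : HasDerivWithinAt (fun t : ℝ => Complex.exp (-((1 - t) * c)))
      (Complex.exp (-c) * c) (Set.Ici 0) 0 := by
    have h1 : HasDerivAt (fun t : ℝ => -((1 - (t : ℂ)) * c)) c 0 := by
      have := (((Complex.ofRealCLM.hasDerivAt (x := 0)).const_sub 1).mul_const c).neg
      simpa using! this
    simpa using h1.cexp.hasDerivWithinAt
  have hmul := (hsol.hasDerivWithinAt_stepFn Y a b ξ η).mul hE
  -- The overlap of the full step functions is that of their futures at time `0`, as the measure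
  -- lives on `[0,∞)`.
  have hinner : cohInner (stepFn a) (stepFn b) = Complex.exp c := by
    have := cohInner_future_stepFn a b le_rfl zero_le_one
    simp only [Complex.ofReal_zero, sub_zero, one_mul] at this
    rw [← this, cohInner_eq, cohInner_eq, integral_ptMeasure (integrable_overlap _ _),
      integral_ptMeasure (integrable_overlap _ _)]
    congr 1
    refine Finset.sum_congr rfl fun n _ => setIntegral_congr_fun measurableSet_Ici fun s hs => ?_
    simp [TestFn.future, Set.mem_Ici.mp hs]
  have heq : ∀ t ∈ Set.Icc (0 : ℝ) 1,
      φ t Y (cohD ((stepFn a).past t) ξ) (cohD ((stepFn b).past t) η) =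
      φ t Y (cohD (stepFn a) ξ) (cohD (stepFn b) η) * Complex.exp (-((1 - t) * c)) := by
    intro t ht
    rw [hsol.adapted t ht.1 Y (stepFn a) (stepFn b) ξ η, cohInner_future_stepFn a b ht.1 ht.2,
      mul_assoc, ← Complex.exp_add, add_neg_cancel, Complex.exp_zero, mul_one]
  refine (hmul.congr_of_eventuallyEq ?_ (heq 0 (by simp))).congr_deriv ?_
  · filter_upwards [Icc_mem_nhdsGE (zero_lt_one' ℝ)] with t ht using heq t ht
  · simp only [hsol.initial_coh, hinner, sum_germEntry, Complex.ofReal_zero, sub_zero, one_mul]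
    have hexp : Complex.exp c * Complex.exp (-c) = 1 := by
      rw [← Complex.exp_add, add_neg_cancel, Complex.exp_zero]
    rw [← hc, Finset.sum_mul]
    simp only [Finset.sum_mul]
    congr 1
    · refine Finset.sum_congr rfl fun μ _ => Finset.sum_congr rfl fun ν _ => ?_
      linear_combination (star (extVec a μ) * extVec b ν *
        inner ℂ ξ ((lam μ ν Y : H →L[ℂ] H) η)) * hexp
    · linear_combination (c * inner ℂ ξ ((Y : H →L[ℂ] H) η)) * hexp

/-! ### Test vectors with prescribed one-particle part -/

/-- The vector `ζ^- δ_∅ + ∑_n ζ^n ⊗ ((e_n 1_{[0,t)})^⊗ - δ_∅)`. -/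
noncomputable def germVec (t : ℝ) (ζ : ExtSpace d H) : CohSpan d H :=
  ∑ i, cohD ((stepFn (basisVal i)).past t) (basisCoeff ζ i)

theorem inner_germ (Y : 𝓑) (ζ ζ' : ExtSpace d H) :
    inner ℂ ζ (germ lam Y ζ') = ∑ μ, ∑ ν, inner ℂ (ζ μ) (germEntry lam μ ν Y (ζ' ν)) := by
  rw [PiLp.inner_apply]
  refine Finset.sum_congr rfl fun μ _ => ?_
  rw [← inner_sum]
  congr 1
  simp [germ, blockOp, germEntry]

/-- Sesquilinear expansion reduces this to pairs of coherent vectors; the coefficients then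
reassemble `ζ` and `ζ'` componentwise. -/
theorem IsQSSolution.hasDerivWithinAt_germVec (hsol : IsQSSolution lam φ) (Y : 𝓑)
    (ζ ζ' : ExtSpace d H) :
    HasDerivWithinAt (fun t => φ t Y (germVec t ζ) (germVec t ζ'))
      (inner ℂ ζ (germ lam Y ζ')) (Set.Ici 0) 0 := by
  have h := HasDerivWithinAt.fun_sum fun i (_ : i ∈ Finset.univ) =>
    HasDerivWithinAt.fun_sum fun j (_ : j ∈ Finset.univ) =>
      hsol.hasDerivWithinAt_past Y (basisVal i) (basisVal j) (basisCoeff ζ i) (basisCoeff ζ' j)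
  have hfun : (fun t => φ t Y (germVec t ζ) (germVec t ζ')) = fun t => ∑ i, ∑ j,
      φ t Y (cohD ((stepFn (basisVal i)).past t) (basisCoeff ζ i))
        (cohD ((stepFn (basisVal j)).past t) (basisCoeff ζ' j)) := by
    ext t
    simp only [germVec, map_sum, LinearMap.sum_apply]
    exact Finset.sum_comm
  rw [hfun]
  refine h.congr_deriv ?_
  have hentry : ∀ μ ν, inner ℂ (ζ μ) (germEntry lam μ ν Y (ζ' ν)) = ∑ i, ∑ j,
      star (extVec (basisVal i) μ) * extVec (basisVal j) ν *
        inner ℂ (basisCoeff ζ i) (germEntry lam μ ν Y (basisCoeff ζ' j)) := fun μ ν => by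
    rw [← sum_extVec_smul_basisCoeff ζ, ← sum_extVec_smul_basisCoeff ζ', map_sum, sum_inner]
    refine Finset.sum_congr rfl fun i _ => ?_
    rw [inner_sum]
    refine Finset.sum_congr rfl fun j _ => ?_
    rw [map_smul, inner_smul_left, inner_smul_right, mul_assoc, Complex.star_def]
  simp only [inner_germ, hentry]
  calc _ = ∑ i, ∑ μ, ∑ j, ∑ ν, _ := Finset.sum_congr rfl fun i _ => Finset.sum_comm
    _ = ∑ μ, ∑ i, ∑ j, ∑ ν, _ := Finset.sum_comm
    _ = ∑ μ, ∑ i, ∑ ν, ∑ j, _ := Finset.sum_congr rfl fun μ _ =>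
        Finset.sum_congr rfl fun i _ => Finset.sum_comm
    _ = _ := Finset.sum_congr rfl fun μ _ => Finset.sum_comm

/-- At time zero every truncated step function vanishes almost everywhere, so all overlaps are `1`
and only the sum of the coefficients, which is `ζ none`, survives. -/
theorem IsQSSolution.germVec_zero (hsol : IsQSSolution lam φ) (Y : 𝓑) (ζ ζ' : ExtSpace d H) :
    φ 0 Y (germVec 0 ζ) (germVec 0 ζ') = inner ℂ (ζ none) ((Y : H →L[ℂ] H) (ζ' none)) := by
  simp only [germVec, map_sum, LinearMap.sum_apply, hsol.initial_coh, cohInner_past_zero,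
    one_mul]
  have h : ∀ ζ : ExtSpace d H, ∑ i, basisCoeff ζ i = ζ none := fun ζ => by
    rw [← sum_extVec_smul_basisCoeff ζ none]
    simp [extVec]
  rw [← h ζ, ← h ζ', map_sum, sum_inner, Finset.sum_comm]
  simp only [inner_sum]

/-! ### Positivity and symmetry -/

theorem nonneg_of_hasDerivWithinAt {F : ℝ → ℂ} {c : ℂ} (hF : HasDerivWithinAt F c (Set.Ici 0) 0)
    (h0 : F 0 = 0) (hpos : ∀ t, 0 < t → 0 ≤ F t) : 0 ≤ c := by
  have h := hasDerivWithinAt_iff_tendsto_slope.mp hF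
  rw [Set.Ici_sdiff_left] at h
  refine ge_of_tendsto h ?_
  filter_upwards [self_mem_nhdsWithin] with t ht
  rw [slope_def_module, h0, sub_zero, sub_zero, Complex.real_smul]
  exact mul_nonneg (by exact_mod_cast (inv_pos.mpr ht).le) (hpos t ht)

/-- Positivity for the pairs `(1, ψ)`, `(Y, χ)` makes the total sum real, and its diagonal terms are
real by themselves. So the two cross terms have opposite imaginary parts. -/
theorem IsCPForm.hermitian {Φ : 𝓑 →ₗ[ℂ] DForm d H} (hΦ : IsCPForm Φ) (Y : 𝓑)
    (χ ψ : CohSpan d H) : Φ (star Y) χ ψ = star (Φ Y ψ χ) := by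
  have hdiag : ∀ (B : 𝓑) (ψ : CohSpan d H), (Φ (star B * B) ψ ψ).im = 0 := fun B ψ => by
    have := hΦ 1 (fun _ => B) (fun _ => ψ)
    simp only [Finset.univ_unique, Finset.sum_singleton] at this
    exact (Complex.nonneg_iff.mp this).2.symm
  have hoff : ∀ χ ψ : CohSpan d H, (Φ Y ψ χ + Φ (star Y) χ ψ).im = 0 := fun χ ψ => by
    have := hΦ 2 ![1, Y] ![ψ, χ]
    simp only [Fin.sum_univ_two, Matrix.cons_val_zero, Matrix.cons_val_one, star_one, one_mul,
      mul_one] at this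
    have him := (Complex.nonneg_iff.mp this).2
    have h1 := hdiag 1 ψ
    have h2 := hdiag Y χ
    simp only [star_one, mul_one] at h1
    simp only [Complex.add_im] at him ⊢
    linarith
  have h1 := hoff χ ψ
  -- The factor `i` enters the two cross terms with opposite signs, which makes their real parts
  -- equal.
  have h2 := hoff χ (Complex.I • ψ)
  simp only [LinearMap.map_smulₛₗ, LinearMap.smul_apply, map_smul, smul_eq_mul, Complex.conj_I,
    Complex.add_im, Complex.mul_im, Complex.neg_re, Complex.neg_im, Complex.I_re,
    Complex.I_im] at h1 h2
  refine Complex.ext ?_ ?_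
  · simp only [Complex.star_def, Complex.conj_re]
    linarith
  · simp only [Complex.star_def, Complex.conj_im]
    linarith

theorem sum_iotaRep_none {N : ℕ} (B : Fin N → 𝓑) (η : Fin N → ExtSpace d H)
    (h : ∑ k, iotaRep d (B k) (η k) = 0) : ∑ k, (B k : H →L[ℂ] H) (η k none) = 0 := by
  have h1 := congrArg (fun ζ : ExtSpace d H => ζ none) h
  simpa [iotaRep, blockOp, Fintype.sum_option] using h1

end Germ

theorem theorem1 {H : Type*} [NormedAddCommGroup H] [InnerProductSpace ℂ H] [CompleteSpace H]
    (d : ℕ) (𝓑 : StarSubalgebra ℂ (H →L[ℂ] H))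
    (lam : NoiseIdx d → NoiseIdx d → 𝓑 →ₗ[ℂ] 𝓑)
    (φ : ℝ → 𝓑 →ₗ[ℂ] DForm d H)
    (hsol : IsQSSolution lam φ)
    (hCP : ∀ t : ℝ, 0 < t → IsCPForm (φ t)) :
    (∀ (N : ℕ) (B : Fin N → 𝓑) (η : Fin N → ExtSpace d H),
      ∑ k, iotaRep d (B k) (η k) = 0 →
        0 ≤ ∑ k, ∑ l, inner ℂ (η k) (germ lam (star (B k) * B l) (η l))) ∧
    (∀ B : 𝓑, germ lam (star B) = ContinuousLinearMap.adjoint (germ lam B)) := by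
  refine ⟨fun N B η hη => ?_, fun B => ?_⟩
  · have hderiv := HasDerivWithinAt.fun_sum fun k (_ : k ∈ Finset.univ) =>
      HasDerivWithinAt.fun_sum fun l (_ : l ∈ Finset.univ) =>
        hsol.hasDerivWithinAt_germVec (star (B k) * B l) (η k) (η l)
    refine nonneg_of_hasDerivWithinAt hderiv ?_ fun t ht =>
      hCP t ht N B fun k => germVec t (η k)
    simp only [hsol.germVec_zero]
    -- At `t = 0` the double sum is `‖∑ B_k η_k^0‖²`, and the hypothesis on `ι` says that this
    -- vector is zero.
    have hz := sum_iotaRep_none B η hη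
    have hstar : ∀ k l, inner ℂ (η k none) (((star (B k) * B l : 𝓑) : H →L[ℂ] H) (η l none)) =
        inner ℂ ((B k : H →L[ℂ] H) (η k none)) ((B l : H →L[ℂ] H) (η l none)) := fun k l =>
      ContinuousLinearMap.adjoint_inner_right (B k : H →L[ℂ] H) _ _
    simp only [hstar, ← inner_sum, hz, inner_zero_right, Finset.sum_const_zero]
  · rw [ContinuousLinearMap.eq_adjoint_iff]
    intro ζ ζ'
    have h1 := hsol.hasDerivWithinAt_germVec B ζ ζ'
    have h2 := (hsol.hasDerivWithinAt_germVec (star B) ζ' ζ).star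
    have hev : ∀ t ∈ Set.Ici (0 : ℝ),
        star (φ t (star B) (germVec t ζ') (germVec t ζ)) = φ t B (germVec t ζ) (germVec t ζ') := by
      intro t ht
      -- Complete positivity is only available for `t > 0`; at `t = 0` the symmetry is read off from
      -- the initial condition.
      rcases eq_or_lt_of_le (Set.mem_Ici.mp ht) with rfl | ht
      · simp only [hsol.germVec_zero, Complex.star_def, inner_conj_symm]
        exact ContinuousLinearMap.adjoint_inner_left (B : H →L[ℂ] H) _ _
      · rw [(hCP t ht).hermitian, star_star]
    have h3 := h1.congr hev (hev 0 (by simp))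
    have := (uniqueDiffWithinAt_Ici (0 : ℝ)).eq_deriv _ h2 h3
    rw [← this, Complex.star_def, inner_conj_symm]
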